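/- Let $\beta:\mathbb{R}_{\ge0}\times\mathbb{R}_{\ge0}\to\mathbb{R}_{\ge0}$ be of class $\mathcal{KL}_0$, i.e. $\beta$ is continuous, $\lim_{t\to\infty}\beta(r,t)=0$ for every $r>0$, and for every $t\ge0$ the function $\beta(\cdot,t)$ is either identically zero or of class $\mathcal{K}_\infty$ (continuous, zero at zero, strictly increasing, unbounded). Suppose that $\beta$ is linear in its first argument and that $\beta(r,n+m)\le\beta(\beta(r,n),m)$ for all $r\ge0$ and $n,m\in\mathbb{N}_0$. For $k\ge1$ put $B_k(r)=\sum_{n=0}^{k-1}\beta(r,n)$ and $\gamma_k=B_k(r)/r$, which does not depend on $r>0$. For integers $N\ge2$ and $1\le m\le N-1$ let $$\alpha_{N,m}^1=\inf\frac{\sum_{n=0}^{N-1}\lambda_n-\nu}{\sum_{n=0}^{m-1}\lambda_n},$$ where the infimum (in the extended reals) is over all $\lambda_0,\dots,\lambda_{N-1},\nu>0$ satisfying $$\sum_{n=k}^{N-1}\lambda_n\le B_{N-k}(\lambda_k)\quad(k=0,\dots,N-2),\qquad \nu\le\sum_{n=0}^{j-1}\lambda_{n+m}+B_{N-j}(\lambda_{j+m})\quad(j=0,\dots,N-m-1).$$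 Let further $\widehat\alpha_{N,m}^1$ denote the explicit value $$\widehat\alpha_{N,m}^1=1-\frac{(\gamma_{m+1}-1)\prod_{i=m+2}^N(\gamma_i-1)\prod_{i=N-m+1}^N(\gamma_i-1)}{\Big(\prod_{i=m+1}^N\gamma_i-(\gamma_{m+1}-1)\prod_{i=m+2}^N(\gamma_i-1)\Big)\Big(\prod_{i=N-m+1}^N\gamma_i-\prod_{i=N-m+1}^N(\gamma_i-1)\Big)}$$ if $\gamma_{m+1}>1$, and $\widehat\alpha_{N,m}^1=1$ if $\gamma_{m+1}\le1$. Then for all $m=1,\dots,\lfloor N/2\rfloor$ $$\alpha_{N,m}^1=\alpha_{N,N-m}^1\qquad\text{and}\qquad \widehat\alpha_{N,m}^1=\widehat\alpha_{N,N-m}^1 .$$ -/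

import Mathlib

open Filter Topology
open scoped NNReal

namespace MPC

/-- Class `𝒦_∞`: continuous, zero at zero, strictly increasing, unbounded. -/
structure IsKInf (ρ : ℝ≥0 → ℝ≥0) : Prop where
  continuous : Continuous ρ
  map_zero : ρ 0 = 0
  strictMono : StrictMono ρ
  unbounded : ¬ BddAbove (Set.range ρ)

/-- Class `𝒦ℒ₀`: `β` is (jointly) continuous, `β(r,t) → 0` as `t → ∞` for each `r > 0`, and for
each `t ≥ 0` either `β(·,t) ∈ 𝒦_∞` or `β(·,t) ≡ 0`. -/
structure IsKL0 (β : ℝ≥0 → ℝ≥0 → ℝ≥0) : Prop where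
  continuous : Continuous fun p : ℝ≥0 × ℝ≥0 => β p.1 p.2
  tendsto_zero : ∀ r, 0 < r → Tendsto (β r) atTop (𝓝 0)
  kinf_or_zero : ∀ t, IsKInf (fun r => β r t) ∨ ∀ r, β r t = 0

/-- `β` is linear in its first argument. -/
def LinearInFirst (β : ℝ≥0 → ℝ≥0 → ℝ≥0) : Prop :=
  ∀ t, IsLinearMap ℝ≥0 fun r => β r t

/-- Submultiplicativity: `β(r, n+m) ≤ β(β(r,n), m)` for all `r ≥ 0` and `n, m ∈ ℕ₀`. -/
def Submultiplicative (β : ℝ≥0 → ℝ≥0 → ℝ≥0) : Prop :=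
  ∀ (r : ℝ≥0) (n m : ℕ), β r ((n + m : ℕ) : ℝ≥0) ≤ β (β r (n : ℝ≥0)) (m : ℝ≥0)

/-- `B_k(r) = ∑_{n=0}^{k-2} β(r,n) + ω β(r,k-1)`, meaningful for `k ≥ 1`. -/
noncomputable def B (β : ℝ≥0 → ℝ≥0 → ℝ≥0) (ω : ℝ≥0) (k : ℕ) (r : ℝ≥0) : ℝ≥0 :=
  ∑ n ∈ Finset.range (k - 1), β r (n : ℝ≥0) + ω * β r ((k - 1 : ℕ) : ℝ≥0)

/-- The constraints on `λ_0, …, λ_{N-1}` (the values of `l` at other indices play no role)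
and `ν`. -/
structure Feasible (β : ℝ≥0 → ℝ≥0 → ℝ≥0) (ω : ℝ≥0) (N m : ℕ) (l : ℕ → ℝ≥0) (ν : ℝ≥0) :
    Prop where
  pos : ∀ n, n < N → 0 < l n
  nu_pos : 0 < ν
  /-- `∑_{n=k}^{N-2} λ_n + ω λ_{N-1} ≤ B_{N-k}(λ_k)` for `k = 0, …, N-2`. -/
  tail_le : ∀ k, k + 2 ≤ N →
    ∑ n ∈ Finset.Ico k (N - 1), l n + ω * l (N - 1) ≤ B β ω (N - k) (l k)
  /-- `ν ≤ ∑_{n=0}^{j-1} λ_{n+m} + B_{N-j}(λ_{j+m})` for `j = 0, …, N-m-1`. -/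
  nu_le : ∀ j, j + m + 1 ≤ N →
    ν ≤ ∑ n ∈ Finset.range j, l (n + m) + B β ω (N - j) (l (j + m))

/-- The objective `(∑_{n=0}^{N-2} λ_n + ω λ_{N-1} - ν) / ∑_{n=0}^{m-1} λ_n`. -/
noncomputable def objective (ω : ℝ≥0) (N m : ℕ) (l : ℕ → ℝ≥0) (ν : ℝ≥0) : ℝ :=
  (∑ n ∈ Finset.range (N - 1), (l n : ℝ) + (ω : ℝ) * (l (N - 1) : ℝ) - (ν : ℝ)) /
    ∑ n ∈ Finset.range m, (l n : ℝ)

/-- The optimal value `α_{N,m}^ω`, an infimum in the extended reals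
(so it is `+∞` if the constraints are infeasible). -/
noncomputable def alpha (β : ℝ≥0 → ℝ≥0 → ℝ≥0) (ω : ℝ≥0) (N m : ℕ) : EReal :=
  sInf {a : EReal | ∃ (l : ℕ → ℝ≥0) (ν : ℝ≥0),
    Feasible β ω N m l ν ∧ a = ((objective ω N m l ν : ℝ) : EReal)}

/-- `γ_k = B_k(r) / r`, which for `β` linear in its first argument is independent of `r > 0`;
here evaluated at `r = 1`. -/
noncomputable def gamma (β : ℝ≥0 → ℝ≥0 → ℝ≥0) (ω : ℝ≥0) (k : ℕ) : ℝ :=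
  (B β ω k 1 : ℝ)

theorem B_div_eq_gamma {β : ℝ≥0 → ℝ≥0 → ℝ≥0} (hlin : LinearInFirst β) (ω : ℝ≥0) (k : ℕ)
    {r : ℝ≥0} (hr : 0 < r) : (B β ω k r : ℝ) / (r : ℝ) = gamma β ω k := by
  have h : ∀ t, β r t = r * β 1 t := fun t => by
    have := (hlin t).map_smul r 1
    simpa using this
  have hB : B β ω k r = r * B β ω k 1 := by
    simp only [B, h, mul_add, Finset.mul_sum]
    ring
  have hr' : (r : ℝ) ≠ 0 := by exact_mod_cast hr.ne'
  rw [hB, gamma, NNReal.coe_mul]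
  field_simp

open Classical in
/-- The explicit value: `1` if `ω ≥ γ_{m+1}`, and the closed formula otherwise. -/
noncomputable def explicitAlpha (β : ℝ≥0 → ℝ≥0 → ℝ≥0) (ω : ℝ≥0) (N m : ℕ) : ℝ :=
  if gamma β ω (m + 1) ≤ (ω : ℝ) then 1
  else
    1 - ((gamma β ω (m + 1) - (ω : ℝ)) * (∏ i ∈ Finset.Icc (m + 2) N, (gamma β ω i - 1)) *
          ∏ i ∈ Finset.Icc (N - m + 1) N, (gamma β ω i - 1)) /
      ((∏ i ∈ Finset.Icc (m + 1) N, gamma β ω i -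
          (gamma β ω (m + 1) - (ω : ℝ)) * ∏ i ∈ Finset.Icc (m + 2) N, (gamma β ω i - 1)) *
        (∏ i ∈ Finset.Icc (N - m + 1) N, gamma β ω i -
          ∏ i ∈ Finset.Icc (N - m + 1) N, (gamma β ω i - 1)))

end MPC

namespace MPC

open Finset

/-! Write c_j = ∏_{i=N-j+1}^N (1 - 1/γ_i), a = c_m, b = c_{N-m}, and T_k = ∑_{n=k}^{N-1} λ_n. The
tail constraint at k says T_{k+1} ≤ (1 - 1/γ_{N-k}) T_k, so T_m ≤ a T_0. In the same way the bounds
on ν contract ν - ∑_{n<j} λ_{n+m}, giving ν - T_m ≤ b ν. Eliminating T_m bounds the objective below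
by 1 - ab/((1-a)(1-b)) (`optimalValue_le_objective`), and swapping m with N - m only swaps a and b.
The bound is attained (`exists_feasible_objective_eq`); submultiplicativity enters there, to secure
the tail constraints left inactive. The closed formula is the same number with denominators cleared
(`explicitAlpha_eq_optimalValue`). This needs γ_k > 1 for k ≥ 2. Otherwise (`slope_trichotomy`) the
problem is infeasible, and both infima are +∞ while both explicit values are 1. -/

/-- The value `β(1,n)`, the slope of the linear map `β(·,n)`. -/
noncomputable def slope (β : ℝ≥0 → ℝ≥0 → ℝ≥0) (n : ℕ) : ℝ := (β 1 (n : ℝ≥0) : ℝ)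

/-- Partial sums of the slopes. -/
noncomputable def slopeSum (β : ℝ≥0 → ℝ≥0 → ℝ≥0) (k : ℕ) : ℝ := ∑ n ∈ range k, slope β n

/-- The contraction product `∏_{i=N-j+1}^{N} (1 - 1 / g_i)`. -/
noncomputable def contraction (g : ℕ → ℝ) (N j : ℕ) : ℝ := ∏ i ∈ range j, (1 - 1 / g (N - i))

/-- The common optimal value, symmetric under `m ↦ N - m`. -/
noncomputable def optimalValue (g : ℕ → ℝ) (N m : ℕ) : ℝ :=
  1 - contraction g N m * contraction g N (N - m) /
    ((1 - contraction g N m) * (1 - contraction g N (N - m)))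

theorem optimalValue_symm (g : ℕ → ℝ) {N m : ℕ} (h : m ≤ N) :
    optimalValue g N (N - m) = optimalValue g N m := by
  unfold optimalValue
  rw [Nat.sub_sub_self h, mul_comm (contraction g N (N - m)), mul_comm (1 - contraction g N (N - m))]

/-! ### Consequences of linearity and submultiplicativity for the slopes -/

section Slopes

variable {β : ℝ≥0 → ℝ≥0 → ℝ≥0}

theorem slope_nonneg (n : ℕ) : 0 ≤ slope β n := NNReal.coe_nonneg _

theorem slopeSum_succ (k : ℕ) : slopeSum β (k + 1) = slopeSum β k + slope β k :=
  sum_range_succ _ _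

theorem slopeSum_mono : Monotone (slopeSum β) :=
  monotone_nat_of_le_succ fun k => by
    rw [slopeSum_succ]; linarith [slope_nonneg (β := β) k]

theorem LinearInFirst.apply_eq (hlin : LinearInFirst β) (r t : ℝ≥0) : β r t = r * β 1 t := by
  simpa using (hlin t).map_smul r 1

theorem B_one_eq (hlin : LinearInFirst β) {k : ℕ} (hk : 1 ≤ k) (r : ℝ≥0) :
    (B β 1 k r : ℝ) = r * slopeSum β k := by
  obtain ⟨k, rfl⟩ := Nat.exists_eq_add_of_le' hk
  have h : B β 1 (k + 1) r = ∑ n ∈ range (k + 1), β r n := by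
    simp [B, sum_range_succ]
  rw [h, NNReal.coe_sum, slopeSum, mul_sum]
  refine sum_congr rfl fun n _ => ?_
  rw [hlin.apply_eq r, NNReal.coe_mul, slope]

theorem gamma_one_eq (hlin : LinearInFirst β) {k : ℕ} (hk : 1 ≤ k) :
    gamma β 1 k = slopeSum β k := by
  rw [gamma, B_one_eq hlin hk, NNReal.coe_one, one_mul]

theorem slope_add_le (hlin : LinearInFirst β) (hsub : Submultiplicative β) (n m : ℕ) :
    slope β (n + m) ≤ slope β n * slope β m := by
  have h := hsub 1 n m
  rw [hlin.apply_eq (β 1 n)] at h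
  exact_mod_cast h

/-- Submultiplicativity gives s_0 ≤ s_0², so s_0 = 0 or s_0 ≥ 1. Since s_n ≤ s_0 s_n and s_{n+1} ≤
s_n s_1, a vanishing s_0 or s_1 annihilates all later slopes. -/
theorem slope_trichotomy (hlin : LinearInFirst β) (hsub : Submultiplicative β) :
    (∀ n, slope β n = 0) ∨ (∀ k, 1 ≤ k → slopeSum β k = 1) ∨
      ∀ k, 2 ≤ k → 1 < slopeSum β k := by
  have hs := slope_add_le hlin hsub
  have hn := slope_nonneg (β := β)
  rcases (hn 0).eq_or_lt with h0 | h0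
  · refine Or.inl fun n => le_antisymm ?_ (hn n)
    have := hs 0 n
    rwa [← h0, zero_mul, zero_add] at this
  have h1 : 1 ≤ slope β 0 := by
    have := hs 0 0
    rw [add_zero] at this
    nlinarith
  right
  by_cases h : slopeSum β 2 ≤ 1
  · left
    have h2 : slopeSum β 2 = slope β 0 + slope β 1 := by simp [slopeSum, sum_range_succ]
    have hz : slope β 1 = 0 := by linarith [hn 1]
    have hz' : ∀ n, slope β (n + 1) = 0 := fun n => le_antisymm (by
      have := hs n 1
      rwa [hz, mul_zero] at this) (hn _)
    intro k hk
    obtain ⟨k, rfl⟩ := Nat.exists_eq_add_of_le' hk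
    rw [slopeSum, sum_range_succ', sum_eq_zero fun n _ => hz' n]
    linarith [hn 1]
  · exact Or.inr fun k hk => (not_le.mp h).trans_le (slopeSum_mono hk)

theorem slopeSum_add_sub_le (hlin : LinearInFirst β) (hsub : Submultiplicative β) (p k : ℕ) :
    slopeSum β (p + k) - slopeSum β p ≤ slope β p * slopeSum β k := by
  rw [slopeSum, sum_range_add, slopeSum, add_sub_cancel_left, slopeSum, mul_sum]
  exact sum_le_sum fun n _ => slope_add_le hlin hsub p n

/-- Submultiplicativity bounds the defect of the contraction product. -/
theorem slopeSum_sub_le_mul_contraction (hlin : LinearInFirst β) (hsub : Submultiplicative β)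
    (hg : ∀ k, 2 ≤ k → 1 < slopeSum β k) {N : ℕ} (p : ℕ) (hp : p < N) :
    slopeSum β N - slopeSum β p ≤ slopeSum β N * contraction (slopeSum β) N p := by
  induction p with
  | zero => simp [slopeSum, contraction]
  | succ p ih =>
    have ih := ih (by omega)
    have hk : 1 < slopeSum β (N - p) := hg _ (by omega)
    have hpos : 0 < slopeSum β (N - p) := one_pos.trans hk
    -- This bounds s_p below by (γ_N - γ_p)/γ_{N-p}, so passing from p to p + 1 shrinks the defect
    -- by at least the factor 1 - 1/γ_{N-p}.
    have hle := slopeSum_add_sub_le hlin hsub p (N - p)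
    rw [Nat.add_sub_cancel' (by omega : p ≤ N)] at hle
    rw [contraction, prod_range_succ, ← contraction, slopeSum_succ, ← mul_assoc]
    have hx : 0 ≤ 1 - 1 / slopeSum β (N - p) := by
      rw [sub_nonneg, div_le_one hpos]; exact hk.le
    refine le_trans ?_ (mul_le_mul_of_nonneg_right ih hx)
    have : (slopeSum β N - slopeSum β p) / slopeSum β (N - p) ≤ slope β p := by
      rwa [div_le_iff₀ hpos]
    rw [mul_sub, mul_one_div, mul_one]
    linarith

end Slopes

/-! ### Contraction products -/

section Contraction

variable {g : ℕ → ℝ} {N : ℕ}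

@[simp] theorem contraction_zero : contraction g N 0 = 1 := by simp [contraction]

theorem contraction_succ (j : ℕ) :
    contraction g N (j + 1) = contraction g N j * (1 - 1 / g (N - j)) :=
  prod_range_succ _ _

/-- The restriction `j < N` keeps the factor with γ_1, which may be 1, out of the product. -/
theorem contraction_pos (hg : ∀ k, 2 ≤ k → 1 < g k) {j : ℕ} (hj : j < N) :
    0 < contraction g N j := by
  refine prod_pos fun i hi => ?_
  have h := hg (N - i) (by have := mem_range.mp hi; omega)
  rw [sub_pos, div_lt_one (one_pos.trans h)]
  exact h

theorem contraction_succ_lt (hg : ∀ k, 2 ≤ k → 1 < g k) {j : ℕ} (hj : j + 1 < N) :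
    contraction g N (j + 1) < contraction g N j := by
  have h := one_pos.trans (hg (N - j) (by omega))
  rw [contraction_succ]
  have := mul_pos (contraction_pos hg (by omega : j < N)) (one_div_pos.mpr h)
  linarith

theorem contraction_lt_one (hg : ∀ k, 2 ≤ k → 1 < g k) {j : ℕ} (hj : 1 ≤ j) (hjN : j < N) :
    contraction g N j < 1 := by
  induction j, hj using Nat.le_induction with
  | base => simpa using contraction_succ_lt hg (j := 0) hjN
  | succ j _ ih => exact (contraction_succ_lt hg hjN).trans (ih (by omega))

theorem contraction_sub_succ (hg : ∀ k, 2 ≤ k → 1 < g k) {j : ℕ} (hj : j + 1 < N) :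
    g (N - j) * (contraction g N j - contraction g N (j + 1)) = contraction g N j := by
  have h := (one_pos.trans (hg (N - j) (by omega))).ne'
  rw [contraction_succ]
  field_simp
  ring

/-- The contraction product as a quotient of products over `Icc`. -/
theorem contraction_mul_prod_Icc (hg : ∀ k, 2 ≤ k → 1 < g k) {j : ℕ} (hj : j < N) :
    contraction g N j * ∏ i ∈ Icc (N - j + 1) N, g i = ∏ i ∈ Icc (N - j + 1) N, (g i - 1) := by
  have h : contraction g N j = ∏ i ∈ Icc (N - j + 1) N, (1 - 1 / g i) := by
    rw [contraction]
    refine prod_bij' (fun i _ => N - i) (fun i _ => N - i) ?_ ?_ ?_ ?_ ?_ <;>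
      intro i hi <;> simp only [mem_range, mem_Icc] at hi ⊢ <;> omega
  rw [h, ← prod_mul_distrib]
  refine prod_congr rfl fun i hi => ?_
  have := (one_pos.trans (hg i (by rw [mem_Icc] at hi; omega))).ne'
  field_simp

end Contraction

/-! ### The optimal value and the closed formula -/

section Value

variable {β : ℝ≥0 → ℝ≥0 → ℝ≥0} {N m : ℕ}

/-- The constraints of `Feasible` for `ω = 1`, read in the real numbers. -/
theorem feasible_one_iff (hlin : LinearInFirst β) {l : ℕ → ℝ≥0} {ν : ℝ≥0} :
    Feasible β 1 N m l ν ↔ (∀ n, n < N → (0 : ℝ) < l n) ∧ (0 : ℝ) < ν ∧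
      (∀ k, k + 2 ≤ N → ∑ n ∈ Ico k N, (l n : ℝ) ≤ l k * slopeSum β (N - k)) ∧
      ∀ j, j + m + 1 ≤ N →
        (ν : ℝ) ≤ ∑ n ∈ range j, (l (n + m) : ℝ) + l (j + m) * slopeSum β (N - j) := by
  have tail : ∀ k, k + 2 ≤ N →
      (∑ n ∈ Ico k (N - 1), l n + 1 * l (N - 1) ≤ B β 1 (N - k) (l k) ↔
        ∑ n ∈ Ico k N, (l n : ℝ) ≤ l k * slopeSum β (N - k)) := fun k hk => by
    rw [← B_one_eq hlin (by omega), one_mul, ← sum_Ico_succ_top (by omega),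
      Nat.sub_add_cancel (by omega), ← NNReal.coe_le_coe, NNReal.coe_sum]
  have nu : ∀ j, j + m + 1 ≤ N →
      (ν ≤ ∑ n ∈ range j, l (n + m) + B β 1 (N - j) (l (j + m)) ↔
        (ν : ℝ) ≤ ∑ n ∈ range j, (l (n + m) : ℝ) + l (j + m) * slopeSum β (N - j)) :=
    fun j hj => by
      rw [← B_one_eq hlin (by omega), ← NNReal.coe_le_coe, NNReal.coe_add, NNReal.coe_sum]
  constructor
  · intro h
    exact ⟨fun n hn => by exact_mod_cast h.pos n hn, by exact_mod_cast h.nu_pos,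
      fun k hk => (tail k hk).mp (h.tail_le k hk), fun j hj => (nu j hj).mp (h.nu_le j hj)⟩
  · rintro ⟨h1, h2, h3, h4⟩
    exact ⟨fun n hn => by exact_mod_cast h1 n hn, by exact_mod_cast h2,
      fun k hk => (tail k hk).mpr (h3 k hk), fun j hj => (nu j hj).mpr (h4 j hj)⟩

theorem objective_one (hN : 1 ≤ N) (l : ℕ → ℝ≥0) (ν : ℝ≥0) :
    objective 1 N m l ν = (∑ n ∈ range N, (l n : ℝ) - ν) / ∑ n ∈ range m, (l n : ℝ) := by
  obtain ⟨N, rfl⟩ := Nat.exists_eq_add_of_le' hN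
  simp [objective, sum_range_succ]

theorem alpha_eq_top (h : ∀ l ν, ¬ Feasible β 1 N m l ν) : alpha β 1 N m = ⊤ := by
  rw [alpha, sInf_eq_top]
  rintro a ⟨l, ν, hf, -⟩
  exact (h l ν hf).elim

theorem not_feasible_of_slope_eq_zero (hlin : LinearInFirst β) (h : ∀ n, slope β n = 0)
    (hm : m < N) (l : ℕ → ℝ≥0) (ν : ℝ≥0) : ¬ Feasible β 1 N m l ν := by
  rw [feasible_one_iff hlin]
  rintro ⟨-, hν, -, h4⟩
  have := h4 0 (by omega)
  simp only [slopeSum, h, range_zero, sum_empty, sum_const_zero, mul_zero, add_zero] at this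
  exact hν.not_ge this

theorem not_feasible_of_slopeSum_eq_one (hlin : LinearInFirst β)
    (h : ∀ k, 1 ≤ k → slopeSum β k = 1) (hN : 2 ≤ N) (l : ℕ → ℝ≥0) (ν : ℝ≥0) :
    ¬ Feasible β 1 N m l ν := by
  rw [feasible_one_iff hlin]
  rintro ⟨h1, -, h3, -⟩
  obtain ⟨N, rfl⟩ := Nat.exists_eq_add_of_le' hN
  -- After the shift of `N` this is the last tail constraint; it reads λ_{N-2} + λ_{N-1} ≤ λ_{N-2}.
  have h3 := h3 N le_rfl
  rw [h _ (by omega), sum_Ico_succ_top (by omega), sum_Ico_succ_top (by omega)] at h3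
  simp only [Ico_self, sum_empty] at h3
  have := h1 (N + 1) (by omega)
  linarith

theorem optimalValue_le_objective (hlin : LinearInFirst β)
    (hg : ∀ k, 2 ≤ k → 1 < slopeSum β k) (hm : 1 ≤ m) (hmN : m < N) {l : ℕ → ℝ≥0} {ν : ℝ≥0}
    (hf : Feasible β 1 N m l ν) : optimalValue (slopeSum β) N m ≤ objective 1 N m l ν := by
  obtain ⟨h1, h2, h3, h4⟩ := (feasible_one_iff hlin).mp hf
  have hD : ∀ k, k + 2 ≤ N → 0 ≤ 1 - 1 / slopeSum β (N - k) := fun k hk => by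
    have := hg (N - k) (by omega)
    rw [sub_nonneg, div_le_one (by linarith)]
    exact this.le
  have hT : ∀ k, k ≤ m → ∑ n ∈ Ico k N, (l n : ℝ) ≤
      contraction (slopeSum β) N k * ∑ n ∈ Ico 0 N, (l n : ℝ) := by
    intro k
    induction k with
    | zero => simp
    | succ k ih =>
      intro hk
      have hx := hD k (by omega)
      have hgk := one_pos.trans (hg (N - k) (by omega))
      have h := h3 k (by omega)
      have ih := mul_le_mul_of_nonneg_right (ih (by omega)) hx
      have hs := sum_eq_sum_Ico_succ_bot (by omega : k < N) fun n => (l n : ℝ)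
      rw [← div_le_iff₀ hgk, div_eq_mul_one_div] at h
      rw [contraction_succ]
      linarith
  have hU : ∀ j, j ≤ N - m → (ν : ℝ) - ∑ n ∈ range j, (l (n + m) : ℝ) ≤
      contraction (slopeSum β) N j * ν := by
    intro j
    induction j with
    | zero => simp
    | succ j ih =>
      intro hj
      have hx := hD j (by omega)
      have hgj := one_pos.trans (hg (N - j) (by omega))
      have h := h4 j (by omega)
      have ih := mul_le_mul_of_nonneg_right (ih (by omega)) hx
      have h : ((ν : ℝ) - ∑ n ∈ range j, (l (n + m) : ℝ)) * (1 / slopeSum β (N - j)) ≤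
          l (j + m) := by
        rw [mul_one_div, div_le_iff₀ hgj]
        linarith
      rw [contraction_succ, sum_range_succ]
      linarith
  have hTm := hT m le_rfl
  have hUm := hU (N - m) le_rfl
  have e1 : ∑ n ∈ range (N - m), (l (n + m) : ℝ) = ∑ n ∈ Ico m N, (l n : ℝ) := by
    rw [sum_Ico_eq_sum_range]
    simp only [add_comm]
  have e2 := sum_range_add_sum_Ico (fun n => (l n : ℝ)) hmN.le
  rw [← range_eq_Ico] at hTm
  rw [e1] at hUm
  rw [objective_one (by omega), optimalValue]
  have ha := contraction_lt_one hg hm hmN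
  have ha0 := contraction_pos hg hmN
  have hb := contraction_lt_one hg (by omega : 1 ≤ N - m) (by omega : N - m < N)
  have hP : 0 < ∑ n ∈ range m, (l n : ℝ) :=
    sum_pos (fun n hn => h1 n ((mem_range.mp hn).trans hmN)) ⟨0, mem_range.mpr hm⟩
  have hb0 := contraction_pos hg (by omega : N - m < N)
  generalize contraction (slopeSum β) N m = a at *
  generalize contraction (slopeSum β) N (N - m) = b at *
  generalize ∑ n ∈ range m, (l n : ℝ) = P at *
  generalize ∑ n ∈ Ico m N, (l n : ℝ) = S at *
  rw [← e2] at hTm ⊢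
  have hab : 0 < (1 - a) * (1 - b) := mul_pos (by linarith) (by linarith)
  -- Chain (ν - S)(1-b)(1-a) ≤ bS(1-a) ≤ abP, with P the first m terms and S the rest.
  have k1 : b * S * (1 - a) ≤ b * (a * P) := by
    rw [mul_assoc]
    exact mul_le_mul_of_nonneg_left (by linarith) hb0.le
  have k2 : ((ν : ℝ) - S) * (1 - b) ≤ b * S := by linarith
  have k3 := mul_le_mul_of_nonneg_right k2 (by linarith : 0 ≤ 1 - a)
  have key : ((ν : ℝ) - S) / P ≤ a * b / ((1 - a) * (1 - b)) := by
    rw [div_le_div_iff₀ hP hab]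
    linarith
  have : (P + S - ν) / P = 1 - (ν - S) / P := by
    field_simp
    ring
  rw [this]
  linarith

/-- The minimizer: all constraints on `ν` and the first `m` tail constraints are active. -/
noncomputable def minimizer (g : ℕ → ℝ) (N m n : ℕ) : ℝ :=
  if n < m then
    (1 - contraction g N (N - m)) / contraction g N m *
      (contraction g N n - contraction g N (n + 1))
  else contraction g N (n - m) - contraction g N (n - m + 1)

theorem minimizer_add (g : ℕ → ℝ) (N m j : ℕ) :
    minimizer g N m (j + m) = contraction g N j - contraction g N (j + 1) := by
  simp [minimizer]

theorem minimizer_pos {g : ℕ → ℝ} (hg : ∀ k, 2 ≤ k → 1 < g k) (hm : 1 ≤ m) (hmN : m < N)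
    {n : ℕ} (hn : n < N) : 0 < minimizer g N m n := by
  have hb := contraction_lt_one hg (by omega : 1 ≤ N - m) (by omega : N - m < N)
  unfold minimizer
  split_ifs with h
  · exact mul_pos (div_pos (by linarith) (contraction_pos hg hmN))
      (sub_pos.mpr (contraction_succ_lt hg (by omega)))
  · exact sub_pos.mpr (contraction_succ_lt hg (by omega))

theorem sum_range_minimizer_of_le (g : ℕ → ℝ) {k : ℕ} (hk : k ≤ m) :
    ∑ n ∈ range k, minimizer g N m n =
      (1 - contraction g N (N - m)) / contraction g N m * (1 - contraction g N k) := by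
  rw [← contraction_zero (g := g) (N := N), ← sum_range_sub' (contraction g N) k, mul_sum]
  refine sum_congr rfl fun n hn => ?_
  rw [minimizer, if_pos ((mem_range.mp hn).trans_le hk)]
  simp

theorem sum_range_minimizer_add (g : ℕ → ℝ) (j : ℕ) :
    ∑ n ∈ range j, minimizer g N m (n + m) = 1 - contraction g N j := by
  simp_rw [minimizer_add]
  rw [sum_range_sub' (contraction g N) j, contraction_zero]

theorem sum_range_minimizer {g : ℕ → ℝ} (hg : ∀ k, 2 ≤ k → 1 < g k) (hmN : m < N) :
    ∑ n ∈ range N, minimizer g N m n =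
      (1 - contraction g N (N - m)) / contraction g N m := by
  have ha := (contraction_pos hg hmN).ne'
  rw [← sum_range_add_sum_Ico _ hmN.le, sum_Ico_eq_sum_range]
  simp_rw [add_comm m]
  rw [sum_range_minimizer_of_le g le_rfl, sum_range_minimizer_add]
  field_simp
  ring

/-- By homogeneity ν = 1. The factor (1-b)/a in `minimizer` makes T_m = 1 - b equal to a T_0, so
both estimates behind the lower bound become equalities. -/
theorem exists_feasible_objective_eq (hlin : LinearInFirst β) (hsub : Submultiplicative β)
    (hg : ∀ k, 2 ≤ k → 1 < slopeSum β k) (hm : 1 ≤ m) (hmN : m < N) :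
    ∃ l ν, Feasible β 1 N m l ν ∧ objective 1 N m l ν = optimalValue (slopeSum β) N m := by
  set g := slopeSum β with hgdef
  have ha := contraction_pos hg hmN
  have ha1 := contraction_lt_one hg hm hmN
  have hb := contraction_lt_one hg (by omega : 1 ≤ N - m) (by omega : N - m < N)
  have hcoe : ∀ n, n < N → ((minimizer g N m n).toNNReal : ℝ) = minimizer g N m n :=
    fun n hn => Real.coe_toNNReal _ (minimizer_pos hg hm hmN hn).le
  refine ⟨fun n => (minimizer g N m n).toNNReal, 1, (feasible_one_iff hlin).mpr
    ⟨fun n hn => ?_, by simp, fun k hk => ?_, fun j hj => ?_⟩, ?_⟩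
  · rw [hcoe n hn]
    exact minimizer_pos hg hm hmN hn
  · rw [hcoe k (by omega), sum_congr rfl fun n hn => hcoe n (mem_Ico.mp hn).2,
      sum_Ico_eq_sub _ (by omega : k ≤ N), sum_range_minimizer hg hmN]
    rcases lt_or_ge k m with h | h
    · rw [sum_range_minimizer_of_le g h.le, minimizer, if_pos h, mul_assoc,
        mul_comm _ (slopeSum β (N - k)), contraction_sub_succ hg (by omega)]
      exact le_of_eq (by ring)
    · obtain ⟨j, rfl⟩ := Nat.exists_eq_add_of_le' h
      have hs : ∑ n ∈ range (j + m), minimizer g N m n =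
          (1 - contraction g N (N - m)) / contraction g N m * (1 - contraction g N m) +
            (1 - contraction g N j) := by
        rw [add_comm j, sum_range_add, sum_range_minimizer_of_le g le_rfl]
        simp_rw [add_comm m]
        rw [sum_range_minimizer_add]
      rw [hs, minimizer_add]
      have hs' : (1 - contraction g N (N - m)) / contraction g N m -
          ((1 - contraction g N (N - m)) / contraction g N m * (1 - contraction g N m) +
            (1 - contraction g N j)) = contraction g N j - contraction g N (N - m) := by
        field_simp
        ring
      rw [hs']
      -- Dividing out c_j reduces the tail constraint at j + m to `slopeSum_sub_le_mul_contraction`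
      -- with horizon N - j.
      have hsplit : contraction g N (N - m) =
          contraction g N j * contraction g (N - j) (N - (j + m)) := by
        unfold contraction
        rw [(by omega : N - m = j + (N - (j + m))), prod_range_add]
        simp only [Nat.sub_sub]
      have hkey := slopeSum_sub_le_mul_contraction hlin hsub hg (N := N - j)
        (N - (j + m)) (by omega)
      have hj := contraction_pos hg (by omega : j < N)
      have hgj := one_pos.trans (hg (N - j) (by omega))
      have hd := contraction_sub_succ hg (by omega : j + 1 < N)
      rw [← hgdef] at hkey ⊢
      rw [hsplit]
      refine le_of_mul_le_mul_left ?_ hgj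
      have := mul_le_mul_of_nonneg_left hkey hj.le
      rw [← mul_assoc, hd]
      linarith
  · rw [hcoe (j + m) (by omega),
      sum_congr rfl fun n hn => hcoe (n + m) (by have := mem_range.mp hn; omega),
      sum_range_minimizer_add, minimizer_add, mul_comm, contraction_sub_succ hg (by omega)]
    simp
  · rw [objective_one (by omega), sum_congr rfl fun n hn => hcoe n (mem_range.mp hn),
      sum_congr rfl fun n hn => hcoe n ((mem_range.mp hn).trans hmN),
      sum_range_minimizer hg hmN, sum_range_minimizer_of_le g le_rfl, optimalValue]
    have h1 : 1 - contraction g N m ≠ 0 := by linarith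
    have h2 : 1 - contraction g N (N - m) ≠ 0 := by linarith
    rw [NNReal.coe_one]
    field_simp
    ring

theorem alpha_eq_optimalValue (hlin : LinearInFirst β) (hsub : Submultiplicative β)
    (hg : ∀ k, 2 ≤ k → 1 < slopeSum β k) (hm : 1 ≤ m) (hmN : m < N) :
    alpha β 1 N m = (optimalValue (slopeSum β) N m : ℝ) := by
  refine IsLeast.csInf_eq ⟨?_, ?_⟩
  · obtain ⟨l, ν, hf, ho⟩ := exists_feasible_objective_eq hlin hsub hg hm hmN
    exact ⟨l, ν, hf, by rw [ho]⟩
  · rintro a ⟨l, ν, hf, rfl⟩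
    exact EReal.coe_le_coe_iff.mpr (optimalValue_le_objective hlin hg hm hmN hf)

theorem explicitAlpha_eq_optimalValue (hlin : LinearInFirst β)
    (hg : ∀ k, 2 ≤ k → 1 < slopeSum β k) (hm : 1 ≤ m) (hmN : m < N) :
    explicitAlpha β 1 N m = optimalValue (slopeSum β) N m := by
  have e : ∀ k ≥ 1, gamma β 1 k = slopeSum β k := fun k hk => gamma_one_eq hlin hk
  -- For ω = 1 the separate factor γ_{m+1} - ω is just the missing first factor of the product.
  have hbot : ((slopeSum β (m + 1) - 1) * ∏ i ∈ Icc (m + 2) N, (slopeSum β i - 1)) =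
      ∏ i ∈ Icc (m + 1) N, (slopeSum β i - 1) := by
    rw [← mul_prod_Ioc_eq_prod_Icc (by omega : m + 1 ≤ N), ← Icc_succ_left_eq_Ioc]
    rfl
  have h1 := contraction_mul_prod_Icc hg hmN
  have h2 := contraction_mul_prod_Icc hg (by omega : N - m < N)
  rw [Nat.sub_sub_self hmN.le] at h2
  have ha1 := contraction_lt_one hg hm hmN
  have hb1 := contraction_lt_one hg (by omega : 1 ≤ N - m) (by omega : N - m < N)
  have p1 : ∏ i ∈ Icc (N - m + 1) N, slopeSum β i ≠ 0 := prod_ne_zero_iff.mpr fun i hi =>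
    (one_pos.trans (hg i (by rw [mem_Icc] at hi; omega))).ne'
  have p2 : ∏ i ∈ Icc (m + 1) N, slopeSum β i ≠ 0 := prod_ne_zero_iff.mpr fun i hi =>
    (one_pos.trans (hg i (by rw [mem_Icc] at hi; omega))).ne'
  rw [explicitAlpha, NNReal.coe_one, e _ (by omega), if_neg (not_le.mpr (hg _ (by omega))),
    prod_congr rfl fun i hi => e i (by rw [mem_Icc] at hi; omega),
    prod_congr rfl fun i hi => e i (by rw [mem_Icc] at hi; omega),
    prod_congr rfl fun i hi => congrArg (· - 1) (e i (by rw [mem_Icc] at hi; omega)),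
    prod_congr rfl fun i hi => congrArg (· - 1) (e i (by rw [mem_Icc] at hi; omega)),
    hbot, ← h1, ← h2, optimalValue]
  have k1 : 1 - contraction (slopeSum β) N m ≠ 0 := by linarith
  have k2 : 1 - contraction (slopeSum β) N (N - m) ≠ 0 := by linarith
  generalize contraction (slopeSum β) N m = a at *
  generalize contraction (slopeSum β) N (N - m) = b at *
  generalize ∏ i ∈ Icc (m + 1) N, slopeSum β i = p at *
  generalize ∏ i ∈ Icc (N - m + 1) N, slopeSum β i = q at *
  rw [(by ring : b * p * (a * q) = (p * q) * (a * b)),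
    (by ring : (p - b * p) * (q - a * q) = (p * q) * ((1 - a) * (1 - b))),
    mul_div_mul_left _ _ (mul_ne_zero p2 p1)]

theorem explicitAlpha_eq_one (hlin : LinearInFirst β) (h : slopeSum β (m + 1) ≤ 1) :
    explicitAlpha β 1 N m = 1 := by
  rw [explicitAlpha, gamma_one_eq hlin (by omega), NNReal.coe_one, if_pos h]

end Value

end MPC

theorem corollary7p4 (β : ℝ≥0 → ℝ≥0 → ℝ≥0) (hβ : MPC.IsKL0 β) (hlin : MPC.LinearInFirst β)
    (hsub : MPC.Submultiplicative β) (N m : ℕ) (hm : 1 ≤ m) (hmN : m ≤ N / 2) :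
    MPC.alpha β 1 N m = MPC.alpha β 1 N (N - m) ∧
      MPC.explicitAlpha β 1 N m = MPC.explicitAlpha β 1 N (N - m) := by
  have hlt : m < N := by omega
  have hlt' : N - m < N := by omega
  rcases MPC.slope_trichotomy hlin hsub with h | h | h
  · have hs : ∀ k, MPC.slopeSum β k ≤ 1 := fun k => by simp [MPC.slopeSum, h]
    rw [MPC.alpha_eq_top (MPC.not_feasible_of_slope_eq_zero hlin h hlt),
      MPC.alpha_eq_top (MPC.not_feasible_of_slope_eq_zero hlin h hlt'),
      MPC.explicitAlpha_eq_one hlin (hs _), MPC.explicitAlpha_eq_one hlin (hs _)]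
    exact ⟨rfl, rfl⟩
  · have hs : ∀ k, MPC.slopeSum β (k + 1) ≤ 1 := fun k => (h _ (by omega)).le
    have hN : 2 ≤ N := by omega
    rw [MPC.alpha_eq_top (MPC.not_feasible_of_slopeSum_eq_one hlin h hN),
      MPC.alpha_eq_top (MPC.not_feasible_of_slopeSum_eq_one hlin h hN),
      MPC.explicitAlpha_eq_one hlin (hs _), MPC.explicitAlpha_eq_one hlin (hs _)]
    exact ⟨rfl, rfl⟩
  · rw [MPC.alpha_eq_optimalValue hlin hsub h hm hlt,
      MPC.alpha_eq_optimalValue hlin hsub h (by omega) hlt',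
      MPC.explicitAlpha_eq_optimalValue hlin h hm hlt,
      MPC.explicitAlpha_eq_optimalValue hlin h (by omega) hlt',
      MPC.optimalValue_symm _ hlt.le]
    exact ⟨rfl, rfl⟩
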